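/- Let $l,\tau>0$, $\beta_1,\beta_2\in\mathbb R$, and let $u$ be a solution of the telegraph problem $u_{tt}+\beta_1u_t+\beta_2u=u_{xx}+f$ on $(0,l)\times(0,\tau)$, $u(x,0)=g_1(x)$, $u_t(x,0)=g_2(x)$ for $0<x<l$, $u(0,t)=h_1(t)$, $u(l,t)=h_2(t)$ for $0<t\le\tau$, where $u,f$ are $C^\infty$ on $D=[0,l]\times[0,\tau]$ and $h_1,h_2$ are $C^\infty$ on $[0,\tau]$. Put $\phi=u_{xx}$ and $\psi(x,t)=\frac{x}{l}(h_2(t)-h_1(t))+h_1(t)$. For $\alpha>-\tfrac12$ let $C^{(\alpha)}_n$ be the Gegenbauer polynomials standardized by $C_n^{(\alpha)}(1)=1$ (so $C_0^{(\alpha)}=1$, $C_1^{(\alpha)}(x)=x$, $(n+2\alpha)C^{(\alpha)}_{n+1}(x)=2(n+\alpha)xC^{(\alpha)}_n(x)-nC^{(\alpha)}_{n-1}(x)$ for $n\ge1$; $\alpha=0$ gives the Chebyshev polynomials $T_n$), let $K_n^{(\alpha)}$ be the leading coefficient of $C_n^{(\alpha)}$, and $C_{L,n}^{(\alpha)}(x)=C_n^{(\alpha)}(2x/L-1)$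 for $x\in[0,L]$. The shifted Gegenbauer-Gauss (SGG) nodes $S_{L,n}^{(\alpha)}$ are the zeros of $C_{L,n+1}^{(\alpha)}$. Put $$\kappa^{(\alpha)}_{L,n}=\frac{\|C^{(\alpha)}_{L,n+1}\|_{L^\infty[0,L]}}{(n+1)!\,|K^{(\alpha)}_{n+1}|}.$$ For $N=(N_x,N_t,M_t)\in\mathbb N^3$ the bound of the total truncation error of the shifted Gegenbauer pseudospectral method with parameter $\alpha$ at $(x,t)\in D$ is $$\begin{aligned}B_N^{(\alpha)}(x,t)={}&\frac{l^{N_x+1}}{2^{N_x+2}}\,x(l+x)\,M_\phi^{(x)}\,\kappa^{(\alpha)}_{l,N_x}\\&+\frac{\tau^{N_t+1}}{2^{N_x+N_t+4}}\,t\,\kappa^{(\alpha)}_{\tau,N_t}\Big(2^{N_x+1}M_\phi^{(t)}\big(x(l+x)(2|\beta_1|+t|\beta_2|)+2t\big)+l^{N_x+1}x(l+x)(2|\beta_1|+t|\beta_2|)M_\phi^{(x,t)}\kappa^{(\alpha)}_{l,N_x}\Big)\\&+\frac{\tau^{M_t+1}}{2^{M_t+2}}\,t\,\kappa^{(\alpha)}_{\tau,M_t}\Big(t\big(M_\psi^{(t)}|\beta_2|+M_f^{(t)}\big)+2M_\psi^{(t)}|\beta_1|\Big),\end{aligned}$$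 where $M_\phi^{(x)},M_\phi^{(t)},M_\phi^{(x,t)},M_\psi^{(t)},M_f^{(t)}$ are the maxima over $D$ of $|\partial_x^{N_x+1}\phi|$, $|\partial_t^{N_t+1}\phi|$, $|\partial_x^{N_x+1}\partial_t^{N_t+1}\phi|$, $|\partial_t^{M_t+1}\psi|$, $|\partial_t^{M_t+1}f|$. Let $\|B_N^{(\alpha)}\|$ be its Chebyshev norm on the SGG grid with the same $\alpha$, i.e. the maximum of $B_N^{(\alpha)}(x,t)$ over $x\in S_{l,N_x}^{(\alpha)}$, $t\in S_{\tau,N_t}^{(\alpha)}$. Then the shifted Chebyshev basis ($\alpha=0$) is asymptotically optimal: for every $\alpha>-\tfrac12$ with $\alpha\ne0$, 1. for all sufficiently large $N_x,N_t,M_t$, $\|B_N^{(0)}\|<\|B_N^{(\alpha)}\|$, unless both are $0$; 2. there is $\rho>1$ such that for all sufficiently large $N_x,N_t,M_t$, $\rho\,\|B_N^{(0)}\|\le\|B_N^{(\alpha)}\|$, and $\rho\,B_N^{(0)}(x,t)\le B_N^{(\alpha)}(x,t)$ at every $(x,t)\in D$; 3. if $\alpha>0$, then for every $R\in\mathbb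 R$ the inequalities of 2 hold with $R$ in place of $\rho$ for all sufficiently large $N_x,N_t,M_t$. -/

import Mathlib

open Set Filter Topology
open scoped ContDiff

noncomputable section

/-- The Gegenbauer polynomial of degree `n` and parameter `α > -1/2`, standardized to take the
value `1` at `1`, given by its three-term recurrence. For `α = 0` it is the Chebyshev polynomial of
the first kind. -/
def gegenbauer (α : ℝ) : ℕ → Polynomial ℝ
  | 0 => 1
  | 1 => Polynomial.X
  | n + 2 =>
      Polynomial.C (((n : ℝ) + 1 + 2 * α)⁻¹) *
        (Polynomial.C (2 * ((n : ℝ) + 1 + α)) * Polynomial.X * gegenbauer α (n + 1)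
          - Polynomial.C ((n : ℝ) + 1) * gegenbauer α n)

/-- The shifted Gegenbauer polynomial on `[0, L]`, that is `x ↦ C_n(2 x / L - 1)`. -/
def shiftedGegenbauer (L α : ℝ) (n : ℕ) : Polynomial ℝ :=
  (gegenbauer α n).comp (Polynomial.C (2 / L) * Polynomial.X - 1)

/-- The shifted Gegenbauer-Gauss nodes: the zeros of the shifted Gegenbauer polynomial of degree
`n + 1`. -/
def sggNodes (L α : ℝ) (n : ℕ) : Finset ℝ :=
  (shiftedGegenbauer L α (n + 1)).roots.toFinset

/-- The maximum norm on `[0, L]` of the shifted Gegenbauer polynomial of degree `n`. -/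
def shiftedGegenbauerNorm (L α : ℝ) (n : ℕ) : ℝ :=
  sSup ((fun x => |(shiftedGegenbauer L α n).eval x|) '' Icc 0 L)

/-- The leading coefficient of the (unshifted) Gegenbauer polynomial of degree `n`. -/
def gegenbauerLead (α : ℝ) (n : ℕ) : ℝ := (gegenbauer α n).leadingCoeff

/-- The factor `‖C_{L,n+1}‖ / ((n+1)! |K_{n+1}|)` of the interpolation error. -/
def errFactor (L α : ℝ) (n : ℕ) : ℝ :=
  shiftedGegenbauerNorm L α (n + 1) / ((n + 1).factorial * |gegenbauerLead α (n + 1)|)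

/-- The closed rectangle `[0, l] × [0, τ]`. -/
def rect (l τ : ℝ) : Set (ℝ × ℝ) := Icc 0 l ×ˢ Icc 0 τ

/-- The `k`-th partial derivative in the first variable (one-sided at the ends of `[0, l]`). -/
def partialX (l : ℝ) (k : ℕ) (v : ℝ → ℝ → ℝ) (x t : ℝ) : ℝ :=
  iteratedDerivWithin k (fun y => v y t) (Icc 0 l) x

/-- The `k`-th partial derivative in the second variable (one-sided at the ends of `[0, τ]`). -/
def partialT (τ : ℝ) (k : ℕ) (v : ℝ → ℝ → ℝ) (x t : ℝ) : ℝ :=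
  iteratedDerivWithin k (fun s => v x s) (Icc 0 τ) t

/-- The maximum of `|v|` over the closed rectangle. -/
def rectMax (l τ : ℝ) (v : ℝ → ℝ → ℝ) : ℝ :=
  sSup ((fun p : ℝ × ℝ => |v p.1 p.2|) '' rect l τ)

/-- `u` solves the telegraph equation `u_tt + β₁ u_t + β₂ u = u_xx + f` on the open rectangle, with
the initial values `g₁, g₂` and the Dirichlet boundary values `h₁, h₂`. -/
structure IsTelegraphSolution (l τ β₁ β₂ : ℝ) (f : ℝ → ℝ → ℝ) (g₁ g₂ h₁ h₂ : ℝ → ℝ)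
    (u : ℝ → ℝ → ℝ) : Prop where
  pde : ∀ x ∈ Ioo 0 l, ∀ t ∈ Ioo 0 τ,
    partialT τ 2 u x t + β₁ * partialT τ 1 u x t + β₂ * u x t = partialX l 2 u x t + f x t
  initial : ∀ x ∈ Ioo 0 l, u x 0 = g₁ x
  initial_deriv : ∀ x ∈ Ioo 0 l, partialT τ 1 u x 0 = g₂ x
  boundary_left : ∀ t ∈ Ioc 0 τ, u 0 t = h₁ t
  boundary_right : ∀ t ∈ Ioc 0 τ, u l t = h₂ t

/-- The linear interpolant in `x` of the boundary values. -/
def boundaryLift (l : ℝ) (h₁ h₂ : ℝ → ℝ) (x t : ℝ) : ℝ :=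
  x / l * (h₂ t - h₁ t) + h₁ t

/-- The bound of the total truncation error of the shifted Gegenbauer pseudospectral method with
parameter `α` at the point `(x, t)`, where `φ = u_xx`, `ψ` is the lift of the boundary values and
`f` is the source term. -/
def truncBound (l τ β₁ β₂ : ℝ) (φ ψ f : ℝ → ℝ → ℝ) (α : ℝ) (Nx Nt Mt : ℕ) (x t : ℝ) : ℝ :=
  let Mφx := rectMax l τ (partialX l (Nx + 1) φ)
  let Mφt := rectMax l τ (partialT τ (Nt + 1) φ)
  let Mφxt := rectMax l τ (partialX l (Nx + 1) (partialT τ (Nt + 1) φ))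
  let Mψt := rectMax l τ (partialT τ (Mt + 1) ψ)
  let Mft := rectMax l τ (partialT τ (Mt + 1) f)
  l ^ (Nx + 1) / 2 ^ (Nx + 2) * (x * (l + x)) * Mφx * errFactor l α Nx
  + τ ^ (Nt + 1) / 2 ^ (Nx + Nt + 4) * t * errFactor τ α Nt *
      (2 ^ (Nx + 1) * Mφt * (x * (l + x) * (2 * |β₁| + t * |β₂|) + 2 * t)
        + l ^ (Nx + 1) * (x * (l + x)) * (2 * |β₁| + t * |β₂|) * Mφxt * errFactor l α Nx)
  + τ ^ (Mt + 1) / 2 ^ (Mt + 2) * t * errFactor τ α Mt *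
      (t * (Mψt * |β₂| + Mft) + 2 * Mψt * |β₁|)

/-- The truncation error bound at the point `p` belonging to a solution `u` of the telegraph
problem; the argument `N` is `(N_x, N_t, M_t)`. -/
def solTruncBound (l τ β₁ β₂ : ℝ) (f : ℝ → ℝ → ℝ) (h₁ h₂ : ℝ → ℝ) (u : ℝ → ℝ → ℝ)
    (α : ℝ) (N : ℕ × ℕ × ℕ) (p : ℝ × ℝ) : ℝ :=
  truncBound l τ β₁ β₂ (partialX l 2 u) (boundaryLift l h₁ h₂) f α N.1 N.2.1 N.2.2 p.1 p.2

/-- The Chebyshev (maximum) norm of the truncation error bound over the grid of shifted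
Gegenbauer-Gauss nodes with the same parameter `α`. -/
def chebTruncBound (l τ β₁ β₂ : ℝ) (f : ℝ → ℝ → ℝ) (h₁ h₂ : ℝ → ℝ) (u : ℝ → ℝ → ℝ)
    (α : ℝ) (N : ℕ × ℕ × ℕ) : ℝ :=
  sSup (solTruncBound l τ β₁ β₂ f h₁ h₂ u α N ''
    {p : ℝ × ℝ | p.1 ∈ sggNodes l α N.1 ∧ p.2 ∈ sggNodes τ α N.2.1})

end

/-! The parameter `α` enters the bound only through the error factors and the grid. At `α = 0` the
polynomial of degree `n + 1` has norm at most 1 and leading coefficient `2 ^ n`, so the ratio of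
error factors is at least `2 ^ n * ‖C‖ / K`, with `K` the leading coefficient of `C`.

For `α > 0`, `‖C‖ ≥ C(1) = 1`, and `2 ^ n / K` is a product of factors `1 + α / (i + 1 + α)`, which
diverges like the harmonic series bounds it from below (`gegenbauer_coeff_self_mul_sum_le`).

For `α < 0` the minimax property of `T_n` gives only a ratio of at least 1. The gain comes from the
next Chebyshev term: in degree `n`, `2 ^ (n - 1) * C / K = T_n + A T_{n-2} + ...` with `A ≤ α < 0`.
Testing against alternating signs at the extrema of `T_n` with weight `2 sin² θ` detects both terms
and yields the ratio `1 - α / 2` (`one_sub_half_le_of_abs_gegenbauer_le`).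

The grids differ too, but the largest node tends to the right end of the interval for every `α`
(`eventually_exists_mem_sggNodes`). Since the bound is increasing, this costs a factor `c ^ 4` with
`c` close to 1, absorbed by any slack in the ratio (`eventually_mul_bounds_le`). -/

/-! ### Coefficients of Gegenbauer polynomials and the Chebyshev case -/

lemma gegenbauer_eval_rec {α : ℝ} (hα : -1 / 2 < α) (n : ℕ) (x : ℝ) :
    ((n : ℝ) + 1 + 2 * α) * (gegenbauer α (n + 2)).eval x =
      2 * ((n : ℝ) + 1 + α) * x * (gegenbauer α (n + 1)).eval x
        - ((n : ℝ) + 1) * (gegenbauer α n).eval x := by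
  have h : (n : ℝ) + 1 + 2 * α ≠ 0 := by
    have : (0 : ℝ) ≤ n := n.cast_nonneg
    linarith
  rw [gegenbauer]
  simp only [Polynomial.eval_mul, Polynomial.eval_sub, Polynomial.eval_C, Polynomial.eval_X]
  rw [← mul_assoc, mul_inv_cancel₀ h, one_mul]

lemma gegenbauer_coeff_rec {α : ℝ} (hα : -1 / 2 < α) (n k : ℕ) :
    ((n : ℝ) + 1 + 2 * α) * (gegenbauer α (n + 2)).coeff (k + 1) =
      2 * ((n : ℝ) + 1 + α) * (gegenbauer α (n + 1)).coeff k
        - ((n : ℝ) + 1) * (gegenbauer α n).coeff (k + 1) := by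
  have h : (n : ℝ) + 1 + 2 * α ≠ 0 := by
    have : (0 : ℝ) ≤ n := n.cast_nonneg
    linarith
  rw [gegenbauer, Polynomial.coeff_C_mul, ← mul_assoc, mul_inv_cancel₀ h, one_mul,
    Polynomial.coeff_sub, mul_assoc, Polynomial.coeff_C_mul, Polynomial.coeff_X_mul,
    Polynomial.coeff_C_mul]

lemma gegenbauer_coeff_eq_zero (α : ℝ) : ∀ {n k : ℕ}, n < k → (gegenbauer α n).coeff k = 0
  | 0, k, h => by simp [gegenbauer, Polynomial.coeff_one, h.ne']
  | 1, k, h => by simp [gegenbauer, Polynomial.coeff_X, h.ne]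
  | n + 2, 0, h => by omega
  | n + 2, k + 1, h => by
    rw [gegenbauer, Polynomial.coeff_C_mul, Polynomial.coeff_sub, mul_assoc,
      Polynomial.coeff_C_mul, Polynomial.coeff_X_mul, Polynomial.coeff_C_mul,
      gegenbauer_coeff_eq_zero α (by omega), gegenbauer_coeff_eq_zero α (by omega)]
    simp

lemma gegenbauer_natDegree_le (α : ℝ) (n : ℕ) : (gegenbauer α n).natDegree ≤ n :=
  Polynomial.natDegree_le_iff_coeff_eq_zero.2 fun _ h => gegenbauer_coeff_eq_zero α h

lemma gegenbauer_coeff_self_rec {α : ℝ} (hα : -1 / 2 < α) (n : ℕ) :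
    ((n : ℝ) + 1 + 2 * α) * (gegenbauer α (n + 2)).coeff (n + 2) =
      2 * ((n : ℝ) + 1 + α) * (gegenbauer α (n + 1)).coeff (n + 1) := by
  rw [gegenbauer_coeff_rec hα n (n + 1), gegenbauer_coeff_eq_zero α (n := n) (by omega)]
  ring

lemma gegenbauer_coeff_self_pos {α : ℝ} (hα : -1 / 2 < α) : ∀ n, 0 < (gegenbauer α n).coeff n
  | 0 => by simp [gegenbauer]
  | 1 => by simp [gegenbauer]
  | n + 2 => by
    have h0 : (0 : ℝ) ≤ n := n.cast_nonneg
    have h := gegenbauer_coeff_self_rec hα n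
    have h1 := gegenbauer_coeff_self_pos hα (n + 1)
    have h2 : 0 < 2 * ((n : ℝ) + 1 + α) * (gegenbauer α (n + 1)).coeff (n + 1) :=
      mul_pos (by linarith) h1
    rw [← h] at h2
    exact pos_of_mul_pos_right h2 (by linarith)

lemma gegenbauer_natDegree {α : ℝ} (hα : -1 / 2 < α) (n : ℕ) : (gegenbauer α n).natDegree = n :=
  le_antisymm (gegenbauer_natDegree_le α n)
    (Polynomial.le_natDegree_of_ne_zero (gegenbauer_coeff_self_pos hα n).ne')

lemma gegenbauerLead_eq_coeff {α : ℝ} (hα : -1 / 2 < α) (n : ℕ) :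
    gegenbauerLead α n = (gegenbauer α n).coeff n := by
  rw [gegenbauerLead, Polynomial.leadingCoeff, gegenbauer_natDegree hα]

lemma gegenbauer_coeff_pred {α : ℝ} (hα : -1 / 2 < α) (n : ℕ) :
    (gegenbauer α (n + 1)).coeff n = 0 := by
  induction n with
  | zero => simp [gegenbauer]
  | succ n ih =>
    have h := gegenbauer_coeff_rec hα n n
    rw [ih, gegenbauer_coeff_eq_zero α (n := n) (by omega)] at h
    have h0 : (0 : ℝ) ≤ n := n.cast_nonneg
    have : (n : ℝ) + 1 + 2 * α ≠ 0 := by linarith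
    simpa [this] using h

/-- With the parity lemma `gegenbauer_coeff_pred`, this fixes the top three coefficients up to
scale, hence the `T_n` and `T_{n-2}` parts of the Chebyshev expansion. -/
lemma gegenbauer_coeff_pred_pred {α : ℝ} (hα : -1 / 2 < α) (n : ℕ) :
    4 * ((n : ℝ) + 1 + α) * (gegenbauer α (n + 2)).coeff n =
      -(((n : ℝ) + 2) * (n + 1) * (gegenbauer α (n + 2)).coeff (n + 2)) := by
  induction n with
  | zero =>
    have h1 : (1 : ℝ) + 2 * α ≠ 0 := by linarith
    have h2 := gegenbauer_coeff_self_rec hα 0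
    have h3 : (1 + 2 * α) * (gegenbauer α 2).coeff 0 = -1 := by
      rw [gegenbauer, Polynomial.coeff_zero_eq_eval_zero]
      simp [gegenbauer, h1]
    simp only [gegenbauer, Polynomial.coeff_X_one, zero_add, Nat.cast_zero] at h2 h3 ⊢
    apply mul_left_cancel₀ h1
    linear_combination 4 * (1 + α) * h3 + 2 * h2
  | succ n ih =>
    have h0 : (0 : ℝ) ≤ n := n.cast_nonneg
    have h1 := gegenbauer_coeff_rec hα (n + 1) n
    have h2 := gegenbauer_coeff_self_rec hα (n + 1)
    have h3 := gegenbauer_coeff_self_rec hα n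
    push_cast at h1 h2 ⊢
    have e1 : (n : ℝ) + 1 + 1 + 2 * α ≠ 0 := by linarith
    have e2 : (n : ℝ) + 1 + α ≠ 0 := by linarith
    have e3 : (n : ℝ) + 1 + 2 * α ≠ 0 := by linarith
    set a := (gegenbauer α (n + 1 + 2)).coeff (n + 1)
    set b := (gegenbauer α (n + 1 + 1)).coeff n
    set c := (gegenbauer α (n + 1)).coeff (n + 1)
    set d := (gegenbauer α (n + 1 + 2)).coeff (n + 1 + 2)
    set e := (gegenbauer α (n + 2)).coeff (n + 2) with he
    -- Everything is expressed through the single leading coefficient `e`.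
    have hb : b = -(((n : ℝ) + 2) * (n + 1) * e) / (4 * ((n : ℝ) + 1 + α)) := by
      rw [eq_div_iff (by positivity)]; linarith
    have hc : c = ((n : ℝ) + 1 + 2 * α) * e / (2 * ((n : ℝ) + 1 + α)) := by
      rw [eq_div_iff (by positivity)]; linarith
    have hd : d = 2 * ((n : ℝ) + 1 + 1 + α) * e / ((n : ℝ) + 1 + 1 + 2 * α) := by
      rw [eq_div_iff e1, ← h2, mul_comm]
    have ha : a = (2 * ((n : ℝ) + 1 + 1 + α) * b - ((n : ℝ) + 1 + 1) * c) /
        ((n : ℝ) + 1 + 1 + 2 * α) := by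
      rw [eq_div_iff e1, ← h1, mul_comm]
    rw [ha, hd, hb, hc]
    field_simp
    ring

lemma gegenbauer_zero_eq_T : ∀ n : ℕ, gegenbauer 0 n = Polynomial.Chebyshev.T ℝ n
  | 0 => by simp [gegenbauer]
  | 1 => by simp [gegenbauer]
  | n + 2 => by
    have h : (n : ℝ) + 1 ≠ 0 := by positivity
    have h2 := Polynomial.Chebyshev.T_add_two ℝ n
    refine Polynomial.funext fun x => ?_
    have h3 := gegenbauer_eval_rec (α := 0) (by norm_num) n x
    rw [gegenbauer_zero_eq_T n, gegenbauer_zero_eq_T (n + 1)] at h3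
    push_cast at h3 ⊢
    rw [h2]
    simp only [Polynomial.eval_sub, Polynomial.eval_mul, Polynomial.eval_X, Polynomial.eval_ofNat]
    apply mul_left_cancel₀ h
    linear_combination h3

lemma gegenbauer_zero_coeff_self (n : ℕ) : (gegenbauer 0 (n + 1)).coeff (n + 1) = 2 ^ n := by
  induction n with
  | zero => simp [gegenbauer]
  | succ n ih =>
    have h := gegenbauer_coeff_self_rec (α := 0) (by norm_num) n
    rw [ih] at h
    have : (n : ℝ) + 1 ≠ 0 := by positivity
    apply mul_left_cancel₀ this
    rw [pow_succ]
    linear_combination h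

lemma gegenbauer_eval_one {α : ℝ} (hα : -1 / 2 < α) : ∀ n, (gegenbauer α n).eval 1 = 1
  | 0 => by simp [gegenbauer]
  | 1 => by simp [gegenbauer]
  | n + 2 => by
    have h0 : (0 : ℝ) ≤ n := n.cast_nonneg
    have h := gegenbauer_eval_rec hα n 1
    rw [gegenbauer_eval_one hα n, gegenbauer_eval_one hα (n + 1)] at h
    have : (n : ℝ) + 1 + 2 * α ≠ 0 := by linarith
    apply mul_left_cancel₀ this
    linarith

/-! ### A refined minimax bound for negative `α` -/

lemma sum_cos_grid_eq_zero {n : ℕ} (hn : n ≠ 0) {m : ℤ} (hm : ¬ (2 * (n : ℤ)) ∣ m) :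
    ∑ k ∈ Finset.range (2 * n), Real.cos (m * (k * Real.pi / n)) = 0 := by
  have hn' : (n : ℝ) ≠ 0 := by exact_mod_cast hn
  have h := Real.sin_mul_sum_cos (2 * n) (m * Real.pi / n) 0
  have e : Real.sin ((2 * n : ℕ) * (m * Real.pi / n) / 2) = 0 := by
    rw [show ((2 * n : ℕ) : ℝ) * (m * Real.pi / n) / 2 = m * Real.pi by
      push_cast; field_simp]
    exact Real.sin_int_mul_pi m
  rw [e, zero_mul] at h
  have hs : Real.sin (m * Real.pi / n / 2) ≠ 0 := by
    intro h0
    obtain ⟨j, hj⟩ := Real.sin_eq_zero_iff.1 h0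
    apply hm
    refine ⟨j, ?_⟩
    have : (m : ℝ) = 2 * n * j := by
      have hp := Real.pi_ne_zero
      field_simp at hj
      linarith
    exact_mod_cast this
  have := (mul_eq_zero.1 h).resolve_left hs
  rw [← this]
  refine Finset.sum_congr rfl fun k _ => ?_
  congr 1
  ring

/-- The alternating sum over the extremal points of the Chebyshev polynomial `T_n` with weight
`2 sin² θ`, as a linear functional on polynomials. -/
noncomputable def gridFunctional (n : ℕ) : Polynomial ℝ →ₗ[ℝ] ℝ :=
  ∑ k ∈ Finset.range (2 * n),
    (Real.cos (n * (k * Real.pi / n)) * (1 - Real.cos (2 * (k * Real.pi / n)))) •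
      Polynomial.leval (Real.cos (k * Real.pi / n))

lemma gridFunctional_apply (n : ℕ) (p : Polynomial ℝ) :
    gridFunctional n p = ∑ k ∈ Finset.range (2 * n),
      (Real.cos (n * (k * Real.pi / n)) * (1 - Real.cos (2 * (k * Real.pi / n)))) *
        p.eval (Real.cos (k * Real.pi / n)) := by
  simp [gridFunctional, LinearMap.sum_apply]

/-- On the grid `sin (n θ) = 0`, so `cos (n θ) cos (j θ) = cos ((n - j) θ)`; the factor `1 - cos (2
θ)` then adds the frequencies shifted by `± 2`. -/
lemma gridFunctional_T {n : ℕ} (hn : n ≠ 0) (j : ℤ) :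
    gridFunctional n (Polynomial.Chebyshev.T ℝ j) =
      ∑ k ∈ Finset.range (2 * n), Real.cos (((n - j : ℤ) : ℝ) * (k * Real.pi / n))
      - 1 / 2 * ∑ k ∈ Finset.range (2 * n), Real.cos (((n - j + 2 : ℤ) : ℝ) * (k * Real.pi / n))
      - 1 / 2 * ∑ k ∈ Finset.range (2 * n),
        Real.cos (((n - j - 2 : ℤ) : ℝ) * (k * Real.pi / n)) := by
  have hn' : (n : ℝ) ≠ 0 := by exact_mod_cast hn
  rw [gridFunctional_apply, Finset.mul_sum, Finset.mul_sum, ← Finset.sum_sub_distrib,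
    ← Finset.sum_sub_distrib]
  refine Finset.sum_congr rfl fun k _ => ?_
  rw [Polynomial.Chebyshev.T_real_cos]
  have hs : Real.sin (n * (k * Real.pi / n)) = 0 := by
    rw [show (n : ℝ) * (k * Real.pi / n) = k * Real.pi by field_simp]
    exact Real.sin_nat_mul_pi k
  set θ := k * Real.pi / n
  have h1 : Real.cos (((n - j : ℤ) : ℝ) * θ) = Real.cos (n * θ) * Real.cos (j * θ) := by
    push_cast
    rw [sub_mul, Real.cos_sub, hs]
    ring
  have h2 : Real.cos (((n - j + 2 : ℤ) : ℝ) * θ) =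
      Real.cos (((n - j : ℤ) : ℝ) * θ) * Real.cos (2 * θ) -
        Real.sin (((n - j : ℤ) : ℝ) * θ) * Real.sin (2 * θ) := by
    rw [← Real.cos_add]
    push_cast
    ring_nf
  have h3 : Real.cos (((n - j - 2 : ℤ) : ℝ) * θ) =
      Real.cos (((n - j : ℤ) : ℝ) * θ) * Real.cos (2 * θ) +
        Real.sin (((n - j : ℤ) : ℝ) * θ) * Real.sin (2 * θ) := by
    rw [← Real.cos_sub]
    push_cast
    ring_nf
  rw [h2, h3, h1]
  ring

lemma gridFunctional_T_self {n : ℕ} (hn : 3 ≤ n) :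
    gridFunctional n (Polynomial.Chebyshev.T ℝ n) = 2 * n := by
  rw [gridFunctional_T (by omega), sum_cos_grid_eq_zero (m := n - n + 2) (by omega) (by
      intro h; have := Int.le_of_dvd (by omega) h; omega),
    sum_cos_grid_eq_zero (m := n - n - 2) (by omega) (by
      intro h; have := Int.le_of_dvd (by omega) ((dvd_neg).2 h); omega)]
  simp

/-- The frequencies are 2, 4 and 0, and only 0 survives; `n ≥ 3` keeps 4 from being a multiple of `2
n`. -/
lemma gridFunctional_T_sub_two {n : ℕ} (hn : 3 ≤ n) :
    gridFunctional n (Polynomial.Chebyshev.T ℝ (n - 2)) = -n := by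
  rw [gridFunctional_T (by omega), sum_cos_grid_eq_zero (m := n - (n - 2)) (by omega) (by
      intro h; have := Int.le_of_dvd (by omega) h; omega),
    sum_cos_grid_eq_zero (m := n - (n - 2) + 2) (by omega) (by
      intro h; have := Int.le_of_dvd (by omega) h; omega)]
  simp

lemma gridFunctional_T_of_lt {n j : ℕ} (hj : j + 2 < n) :
    gridFunctional n (Polynomial.Chebyshev.T ℝ j) = 0 := by
  rw [gridFunctional_T (by omega), sum_cos_grid_eq_zero (m := n - j) (by omega) (by
      intro h; have := Int.le_of_dvd (by omega) h; omega),
    sum_cos_grid_eq_zero (m := n - j + 2) (by omega) (by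
      intro h; have := Int.le_of_dvd (by omega) h; omega),
    sum_cos_grid_eq_zero (m := n - j - 2) (by omega) (by
      intro h; have := Int.le_of_dvd (by omega) h; omega)]
  simp

lemma gridFunctional_eq_zero {n : ℕ} : ∀ (d : ℕ) (_ : d + 2 ≤ n) (p : Polynomial ℝ)
    (_ : ∀ k, d ≤ k → p.coeff k = 0), gridFunctional n p = 0
  | 0, _, p, hp => by
    rw [show p = 0 from Polynomial.ext fun k => by simpa using hp k (Nat.zero_le k), map_zero]
  | d + 1, hd, p, hp => by
    have hT := gegenbauer_coeff_self_pos (α := 0) (by norm_num) d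
    set c := p.coeff d / (gegenbauer 0 d).coeff d with hc
    have h := gridFunctional_eq_zero (n := n) d (by omega) (p - c • gegenbauer 0 d) fun k hk => by
      rw [Polynomial.coeff_sub, Polynomial.coeff_smul, smul_eq_mul]
      rcases hk.eq_or_lt with rfl | hk
      · rw [hc, div_mul_cancel₀ _ hT.ne', sub_self]
      · rw [hp k hk, gegenbauer_coeff_eq_zero 0 hk, mul_zero, sub_zero]
    rwa [map_sub, map_smul, gegenbauer_zero_eq_T, gridFunctional_T_of_lt (by omega), smul_zero,
      sub_zero] at h

/-- The weights `1 - cos (2 θ)` are nonnegative with sum `2 n`. -/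
lemma gridFunctional_abs_le {n : ℕ} (hn : 3 ≤ n) {p : Polynomial ℝ} {S : ℝ}
    (hS : ∀ x ∈ Icc (-1 : ℝ) 1, |p.eval x| ≤ S) : |gridFunctional n p| ≤ 2 * n * S := by
  have hw : ∑ k ∈ Finset.range (2 * n), (1 - Real.cos (2 * (k * Real.pi / n))) = 2 * n := by
    have h := sum_cos_grid_eq_zero (n := n) (m := 2) (by omega) (by
      intro h; have := Int.le_of_dvd (by omega) h; omega)
    push_cast at h
    rw [Finset.sum_sub_distrib, h]
    simp
  rw [gridFunctional_apply, ← hw, Finset.sum_mul]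
  refine (Finset.abs_sum_le_sum_abs _ _).trans (Finset.sum_le_sum fun k _ => ?_)
  have h1 : 0 ≤ 1 - Real.cos (2 * (k * Real.pi / n)) := sub_nonneg.2 (Real.cos_le_one _)
  rw [abs_mul, abs_mul, abs_of_nonneg h1]
  have h2 := hS _ ⟨Real.neg_one_le_cos (k * Real.pi / n), Real.cos_le_one _⟩
  calc _ ≤ 1 * (1 - Real.cos (2 * (k * Real.pi / n))) * S := by
        gcongr
        exact Real.abs_cos_le_one _
    _ = _ := by ring

/-- With `n = m + 3`, subtracting `K (T_n + A T_{n-2})` from `2 ^ (n - 1) C_n` leaves degree at most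
`n - 3`, which the functional kills. The values `2 n` and `-n` at `T_n` and `T_{n-2}` remain. -/
lemma gridFunctional_gegenbauer {α : ℝ} (hα : -1 / 2 < α) (m : ℕ) :
    2 ^ (m + 2) * gridFunctional (m + 3) (gegenbauer α (m + 3)) =
      (gegenbauer α (m + 3)).coeff (m + 3) *
        (((m : ℝ) + 3) * (2 - α * ((m : ℝ) + 3) / ((m : ℝ) + 2 + α))) := by
  have hm : (0 : ℝ) ≤ m := m.cast_nonneg
  have hne : (m : ℝ) + 2 + α ≠ 0 := by linarith
  set K := (gegenbauer α (m + 3)).coeff (m + 3) with hK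
  set A := α * ((m : ℝ) + 3) / ((m : ℝ) + 2 + α) with hA
  have h0 : gridFunctional (m + 3) ((2 : ℝ) ^ (m + 2) • gegenbauer α (m + 3)
      - K • (gegenbauer 0 (m + 3) + A • gegenbauer 0 (m + 1))) = 0 := by
    refine gridFunctional_eq_zero (m + 1) le_rfl _ fun k hk => ?_
    simp only [Polynomial.coeff_sub, Polynomial.coeff_add, Polynomial.coeff_smul, smul_eq_mul]
    rcases (show k = m + 1 ∨ k = m + 2 ∨ k = m + 3 ∨ m + 3 < k by omega) with rfl | rfl | rfl | hk
    · have h1 := gegenbauer_coeff_pred_pred hα (m + 1)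
      have h2 := gegenbauer_coeff_pred_pred (α := 0) (by norm_num) (m + 1)
      have e1 := gegenbauer_zero_coeff_self m
      have e2 := gegenbauer_zero_coeff_self (m + 2)
      rw [show m + 1 + 2 = m + 3 by rfl] at h1 h2
      rw [show m + 2 + 1 = m + 3 by rfl] at e2
      rw [e2] at h2
      rw [← hK] at h1
      rw [e1]
      push_cast at h1 h2
      have h1' : (gegenbauer α (m + 3)).coeff (m + 1) =
          -(((m : ℝ) + 3) * (m + 2) * K) / (4 * ((m : ℝ) + 2 + α)) := by
        rw [eq_div_iff (by positivity)]
        linear_combination h1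
      have h2' : (gegenbauer 0 (m + 3)).coeff (m + 1) = -(((m : ℝ) + 3) * 2 ^ m) := by
        have : (m : ℝ) + 2 ≠ 0 := by positivity
        apply mul_left_cancel₀ this
        rw [pow_add] at h2
        linear_combination h2 / 4
      rw [h1', h2', hA, pow_add]
      field_simp
      ring
    · have h1 := gegenbauer_coeff_pred hα (m + 2)
      have h2 := gegenbauer_coeff_pred (α := 0) (by norm_num) (m + 2)
      rw [show m + 2 + 1 = m + 3 by rfl] at h1 h2
      rw [h1, h2, gegenbauer_coeff_eq_zero 0 (by omega)]
      ring
    · rw [gegenbauer_zero_coeff_self (m + 2), gegenbauer_coeff_eq_zero 0 (n := m + 1) (by omega),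
        ← hK]
      ring
    · rw [gegenbauer_coeff_eq_zero α hk, gegenbauer_coeff_eq_zero 0 hk,
        gegenbauer_coeff_eq_zero 0 (n := m + 1) (by omega)]
      ring
  have hT := gridFunctional_T_self (n := m + 3) (by omega)
  have hT2 := gridFunctional_T_sub_two (n := m + 3) (by omega)
  rw [show ((m + 3 : ℕ) : ℤ) - 2 = ((m + 1 : ℕ) : ℤ) by push_cast; ring] at hT2
  rw [map_sub, map_smul, map_smul, map_add, map_smul, gegenbauer_zero_eq_T, gegenbauer_zero_eq_T,
    hT, hT2] at h0
  push_cast at h0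
  simp only [smul_eq_mul] at h0
  linear_combination h0

lemma one_sub_half_le_of_abs_gegenbauer_le {α : ℝ} (hα : -1 / 2 < α) (hα1 : α < 0) (m : ℕ) {S : ℝ}
    (hS : ∀ x ∈ Icc (-1 : ℝ) 1, |(gegenbauer α (m + 3)).eval x| ≤ S) :
    (1 - α / 2) * (gegenbauer α (m + 3)).coeff (m + 3) ≤ 2 ^ (m + 2) * S := by
  have hm : (0 : ℝ) ≤ m := m.cast_nonneg
  have hK := gegenbauer_coeff_self_pos hα (m + 3)
  have h1 := gridFunctional_gegenbauer hα m
  have h2 := (le_abs_self _).trans (gridFunctional_abs_le (n := m + 3) (by omega) hS)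
  have h3 : α * ((m : ℝ) + 3) / ((m : ℝ) + 2 + α) ≤ α := by
    rw [div_le_iff₀ (by linarith)]
    exact mul_le_mul_of_nonpos_left (by linarith) hα1.le
  have h4 := mul_le_mul_of_nonneg_left h2 (show (0 : ℝ) ≤ 2 ^ (m + 2) by positivity)
  rw [h1] at h4
  have h5 : (gegenbauer α (m + 3)).coeff (m + 3) * (((m : ℝ) + 3) * (2 - α)) ≤
      2 ^ (m + 2) * (2 * ((m + 3 : ℕ) : ℝ) * S) := by
    refine le_trans ?_ h4
    gcongr
  push_cast at h5
  have h6 : (0 : ℝ) < 2 * (m + 3) := by positivity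
  refine le_of_mul_le_mul_left ?_ h6
  linarith

/-! ### Comparison of the error factors -/

lemma shiftedGegenbauer_eval (L α : ℝ) (n : ℕ) (x : ℝ) :
    (shiftedGegenbauer L α n).eval x = (gegenbauer α n).eval (2 / L * x - 1) := by
  simp [shiftedGegenbauer, Polynomial.eval_comp]

lemma abs_gegenbauer_le_shiftedGegenbauerNorm {L : ℝ} (hL : 0 < L) (α : ℝ) (n : ℕ) {y : ℝ}
    (hy : y ∈ Icc (-1 : ℝ) 1) : |(gegenbauer α n).eval y| ≤ shiftedGegenbauerNorm L α n := by
  refine le_csSup (isCompact_Icc.image_of_continuousOn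
    (shiftedGegenbauer L α n).continuous.abs.continuousOn).bddAbove ⟨L * (y + 1) / 2, ⟨?_, ?_⟩, ?_⟩
  · have := mul_nonneg hL.le (show 0 ≤ y + 1 by linarith [hy.1])
    linarith
  · have := mul_le_mul_of_nonneg_left (show y + 1 ≤ 2 by linarith [hy.2]) hL.le
    linarith
  · have : 2 / L * (L * (y + 1) / 2) - 1 = y := by field_simp; ring
    simp only [shiftedGegenbauer_eval, this]

lemma shiftedGegenbauerNorm_zero_le_one {L : ℝ} (hL : 0 < L) (n : ℕ) :
    shiftedGegenbauerNorm L 0 n ≤ 1 := by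
  refine Real.sSup_le ?_ zero_le_one
  rintro _ ⟨x, hx, rfl⟩
  simp only [shiftedGegenbauer_eval, gegenbauer_zero_eq_T]
  refine Polynomial.Chebyshev.abs_eval_T_real_le_one n (abs_le.2 ⟨?_, ?_⟩)
  · have : 0 ≤ 2 / L * x := mul_nonneg (by positivity) hx.1
    linarith
  · have : 2 / L * x ≤ 2 := by rw [div_mul_eq_mul_div, div_le_iff₀ hL]; linarith [hx.2]
    linarith

lemma errFactor_nonneg (L α : ℝ) (n : ℕ) : 0 ≤ errFactor L α n := by
  refine div_nonneg (Real.sSup_nonneg ?_) (by positivity)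
  rintro _ ⟨x, _, rfl⟩
  exact abs_nonneg _

lemma mul_errFactor_zero_le {L α : ℝ} (hL : 0 < L) (hα : -1 / 2 < α) {n : ℕ} {ρ : ℝ}
    (hρ : 0 ≤ ρ)
    (h : ρ * (gegenbauer α (n + 1)).coeff (n + 1) ≤ 2 ^ n * shiftedGegenbauerNorm L α (n + 1)) :
    ρ * errFactor L 0 n ≤ errFactor L α n := by
  have hK := gegenbauer_coeff_self_pos hα (n + 1)
  have hF : (0 : ℝ) < (n + 1).factorial := by positivity
  have h1 : errFactor L 0 n ≤ 1 / ((n + 1).factorial * 2 ^ n) := by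
    rw [errFactor, gegenbauerLead_eq_coeff (by norm_num), gegenbauer_zero_coeff_self,
      abs_of_pos (by positivity)]
    gcongr
    exact shiftedGegenbauerNorm_zero_le_one hL _
  refine (mul_le_mul_of_nonneg_left h1 hρ).trans ?_
  rw [errFactor, gegenbauerLead_eq_coeff hα, abs_of_pos hK, mul_one_div,
    div_le_div_iff₀ (by positivity) (by positivity)]
  calc _ = (ρ * (gegenbauer α (n + 1)).coeff (n + 1)) * (n + 1).factorial := by ring
    _ ≤ (2 ^ n * shiftedGegenbauerNorm L α (n + 1)) * (n + 1).factorial := by gcongr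
    _ = _ := by ring

lemma one_sub_half_mul_errFactor_le {α : ℝ} (hα : -1 / 2 < α) (hα1 : α < 0) {L : ℝ} (hL : 0 < L)
    {n : ℕ} (hn : 2 ≤ n) : (1 - α / 2) * errFactor L 0 n ≤ errFactor L α n := by
  obtain ⟨m, rfl⟩ := Nat.exists_eq_add_of_le' hn
  exact mul_errFactor_zero_le hL hα (by linarith)
    (one_sub_half_le_of_abs_gegenbauer_le hα hα1 m
      fun x hx => abs_gegenbauer_le_shiftedGegenbauerNorm hL α _ hx)

/-- Raising the degree divides `K / 2 ^ n` by `1 + α / (n + 1 + α)`, and `n + 1 + α ≤ (n + 1) (1 +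
α)` explains the constant `α / (1 + α)`. -/
lemma gegenbauer_coeff_self_mul_sum_le {α : ℝ} (hα : 0 < α) (n : ℕ) :
    (1 + α / (1 + α) * ∑ i ∈ Finset.range n, 1 / ((i : ℝ) + 1)) *
      (gegenbauer α (n + 1)).coeff (n + 1) ≤ 2 ^ n := by
  induction n with
  | zero => simp [gegenbauer]
  | succ n ih =>
    have hα' : -1 / 2 < α := by linarith
    have h := gegenbauer_coeff_self_rec hα' n
    have hK := gegenbauer_coeff_self_pos hα' (n + 1)
    have hn : (0 : ℝ) ≤ n := n.cast_nonneg
    rw [Finset.sum_range_succ]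
    set s := ∑ i ∈ Finset.range n, 1 / ((i : ℝ) + 1) with hs
    have hs0 : 0 ≤ s := Finset.sum_nonneg fun i _ => by positivity
    have hp : 0 < (n : ℝ) + 1 + 2 * α := by positivity
    refine le_of_mul_le_mul_left ?_ hp
    have h1 : (1 + α / (1 + α) * (s + 1 / ((n : ℝ) + 1))) * ((n : ℝ) + 1 + α) ≤
        (1 + α / (1 + α) * s) * ((n : ℝ) + 1 + 2 * α) := by
      have h2 : α / (1 + α) * (1 / ((n : ℝ) + 1)) * ((n : ℝ) + 1 + α) ≤ α := by
        rw [div_mul_div_comm, div_mul_eq_mul_div, div_le_iff₀ (by positivity)]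
        nlinarith [mul_nonneg hα.le (mul_nonneg hn hα.le)]
      have h3 : 0 ≤ α / (1 + α) * s * α := by positivity
      nlinarith
    calc _ = (1 + α / (1 + α) * (s + 1 / ((n : ℝ) + 1))) * (((n : ℝ) + 1 + 2 * α) *
          (gegenbauer α (n + 2)).coeff (n + 2)) := by ring
      _ = 2 * ((1 + α / (1 + α) * (s + 1 / ((n : ℝ) + 1))) * ((n : ℝ) + 1 + α)) *
          (gegenbauer α (n + 1)).coeff (n + 1) := by rw [h]; ring
      _ ≤ 2 * ((1 + α / (1 + α) * s) * ((n : ℝ) + 1 + 2 * α)) *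
          (gegenbauer α (n + 1)).coeff (n + 1) := by gcongr
      _ = 2 * ((n : ℝ) + 1 + 2 * α) * ((1 + α / (1 + α) * s) *
          (gegenbauer α (n + 1)).coeff (n + 1)) := by ring
      _ ≤ 2 * ((n : ℝ) + 1 + 2 * α) * 2 ^ n := by gcongr
      _ = _ := by rw [pow_succ]; ring

lemma eventually_mul_errFactor_le {α : ℝ} (hα : 0 < α) {ρ : ℝ} (hρ : 0 ≤ ρ) :
    ∀ᶠ n in atTop, ∀ L : ℝ, 0 < L → ρ * errFactor L 0 n ≤ errFactor L α n := by
  have ht := Real.tendsto_sum_range_one_div_nat_succ_atTop.const_mul_atTop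
    (show 0 < α / (1 + α) by positivity)
  filter_upwards [ht.eventually_ge_atTop ρ] with n hn L hL
  have hα' : -1 / 2 < α := by linarith
  have hK := gegenbauer_coeff_self_pos hα' (n + 1)
  refine mul_errFactor_zero_le hL hα' hρ ?_
  have h1 : 1 ≤ shiftedGegenbauerNorm L α (n + 1) := by
    have := abs_gegenbauer_le_shiftedGegenbauerNorm hL α (n + 1) (y := 1) (by simp)
    rwa [gegenbauer_eval_one hα', abs_one] at this
  calc _ ≤ (1 + α / (1 + α) * ∑ i ∈ Finset.range n, 1 / ((i : ℝ) + 1)) *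
      (gegenbauer α (n + 1)).coeff (n + 1) := by gcongr; linarith
    _ ≤ 2 ^ n * 1 := by rw [mul_one]; exact gegenbauer_coeff_self_mul_sum_le hα n
    _ ≤ _ := by gcongr

/-! ### The largest node tends to the right end -/

lemma gegenbauer_eval_pos_and_mono {α : ℝ} (hα : -1 / 2 < α) {x : ℝ} (hx : 1 ≤ x) (n : ℕ) :
    0 < (gegenbauer α n).eval x ∧ (gegenbauer α n).eval x ≤ (gegenbauer α (n + 1)).eval x := by
  induction n with
  | zero => simpa [gegenbauer] using hx
  | succ n ih =>
    have h := gegenbauer_eval_rec hα n x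
    have hn : (0 : ℝ) ≤ n := n.cast_nonneg
    obtain ⟨h1, h2⟩ := ih
    have h3 : 0 < (gegenbauer α (n + 1)).eval x := h1.trans_le h2
    refine ⟨h3, ?_⟩
    have hp : 0 < (n : ℝ) + 1 + 2 * α := by linarith
    have hq : 0 ≤ 2 * ((n : ℝ) + 1 + α) := by linarith
    refine le_of_mul_le_mul_left ?_ hp
    have h4 := mul_le_mul_of_nonneg_left (mul_le_mul_of_nonneg_right hx h3.le) hq
    have h5 := mul_le_mul_of_nonneg_left h2 (show (0 : ℝ) ≤ (n : ℝ) + 1 by positivity)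
    rw [show n + 1 + 1 = n + 2 from rfl, h]
    linarith

/-- At the largest root of `C_{k+1}` the recurrence gives `C_{k+2}` the sign opposite to `C_k`,
hence negative; as `C_{k+2}(1) = 1`, its largest root lies further right. -/
lemma exists_largest_root_gegenbauer {α : ℝ} (hα : -1 / 2 < α) (k : ℕ) :
    ∃ z : ℝ, (gegenbauer α (k + 1)).eval z = 0 ∧
      (∀ x, z < x → 0 < (gegenbauer α (k + 1)).eval x) ∧
      ∀ x, z ≤ x → 0 < (gegenbauer α k).eval x := by
  induction k with
  | zero => exact ⟨0, by simp [gegenbauer], by simp [gegenbauer], by simp [gegenbauer]⟩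
  | succ k ih =>
    obtain ⟨z, hz, hpos, hpos'⟩ := ih
    have hk : (0 : ℝ) ≤ k := k.cast_nonneg
    have hz1 : z < 1 := by
      by_contra! h
      exact (gegenbauer_eval_pos_and_mono hα h (k + 1)).1.ne' hz
    have hneg : (gegenbauer α (k + 2)).eval z < 0 := by
      have h := gegenbauer_eval_rec hα k z
      rw [hz] at h
      have h1 := mul_pos (show (0 : ℝ) < (k : ℝ) + 1 by positivity) (hpos' z le_rfl)
      have hp : 0 < (k : ℝ) + 1 + 2 * α := by linarith
      by_contra! h2
      have := mul_nonneg hp.le h2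
      linarith
    have hcont := (gegenbauer α (k + 2)).continuous
    -- The last point of `[z, 1]` where `C_{k+2} ≤ 0`; a negative value there would force a later
    -- zero.
    obtain ⟨w, ⟨⟨hzw, hw1⟩, hw0⟩, hmax⟩ :=
      (isCompact_Icc.inter_right (isClosed_le hcont continuous_const) :
        IsCompact (Icc z 1 ∩ {x | (gegenbauer α (k + 2)).eval x ≤ 0})).exists_isGreatest
        ⟨z, ⟨le_rfl, hz1.le⟩, hneg.le⟩
    have hone := gegenbauer_eval_one hα (k + 2)
    have hw : (gegenbauer α (k + 2)).eval w = 0 := by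
      refine le_antisymm hw0 ?_
      by_contra! hlt
      obtain ⟨v, hv, hv0⟩ := intermediate_value_Icc hw1 hcont.continuousOn
        (show (0 : ℝ) ∈ Icc _ _ from ⟨hlt.le, by rw [hone]; exact zero_le_one⟩)
      have hvw : v ≤ w := hmax ⟨⟨hzw.trans hv.1, hv.2⟩, hv0.le⟩
      rw [le_antisymm hvw hv.1] at hv0
      exact hlt.ne hv0
    have hzw' : z < w := hzw.lt_of_ne fun h => by rw [h] at hneg; exact hneg.ne hw
    refine ⟨w, hw, fun x hx => ?_, fun x hx => hpos x (hzw'.trans_le hx)⟩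
    rcases le_total 1 x with h1 | h1
    · exact (gegenbauer_eval_pos_and_mono hα h1 (k + 2)).1
    · by_contra! h2
      exact absurd (hmax ⟨⟨hzw.trans hx.le, h1⟩, h2⟩) (not_le.2 hx)

/-- Otherwise the ratios `s k` of consecutive values stay positive. They satisfy nearly `s (k + 1) =
2 y - 1 / s k`, and `s + 1 / s ≥ 2` makes them drop by a fixed amount at each late step. -/
lemma exists_gegenbauer_eval_nonpos {α : ℝ} (hα : -1 / 2 < α) {y : ℝ} (hy0 : 0 ≤ y) (hy : y < 1) :
    ∃ k, (gegenbauer α k).eval y ≤ 0 := by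
  by_contra! hpos
  -- The limiting drop is `2 (1 - y) = 6 ε`; the approximations cost `3 ε`, leaving `1 - y`.
  set ε := (1 - y) / 3 with hε
  have hε0 : 0 < ε := by rw [hε]; linarith
  have hε1 : ε ≤ 1 / 3 := by rw [hε]; linarith
  set s : ℕ → ℝ := fun k => (gegenbauer α (k + 1)).eval y / (gegenbauer α k).eval y with hs
  have hs0 : ∀ k, 0 < s k := fun k => div_pos (hpos _) (hpos _)
  have hstep : ∀ᶠ k : ℕ in atTop, s (k + 1) ≤ s k - (1 - y) := by
    filter_upwards [(tendsto_natCast_atTop_atTop (R := ℝ)).eventually_ge_atTop (2 * |α| / ε)]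
      with k hk
    have hk0 : (0 : ℝ) ≤ k := k.cast_nonneg
    have hp : 0 < (k : ℝ) + 1 + 2 * α := by linarith
    rw [div_le_iff₀ hε0] at hk
    have hrec : ((k : ℝ) + 1 + 2 * α) * s (k + 1) =
        2 * ((k : ℝ) + 1 + α) * y - ((k : ℝ) + 1) / s k := by
      have h := gegenbauer_eval_rec hα k y
      have h1 := (hpos k).ne'
      have h2 := (hpos (k + 1)).ne'
      simp only [hs]
      rw [show k + 1 + 1 = k + 2 from rfl, mul_div_assoc', h]
      field_simp
    have hsk := hs0 k
    have hb : (1 - ε) * ((k : ℝ) + 1 + 2 * α) ≤ (k : ℝ) + 1 := by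
      nlinarith [le_abs_self α, neg_abs_le α]
    have ha : 2 * ((k : ℝ) + 1 + α) * y ≤ (2 * y + ε) * ((k : ℝ) + 1 + 2 * α) := by
      have : -(|α| * 1) ≤ α * y := by
        have := mul_le_mul_of_nonneg_left hy.le (abs_nonneg α)
        nlinarith [neg_abs_le α]
      nlinarith [le_abs_self α, neg_abs_le α]
    have h1 : (1 - ε) * ((k : ℝ) + 1 + 2 * α) / s k ≤ ((k : ℝ) + 1) / s k := by gcongr
    have h2 : 2 * (1 - ε) ≤ s k + (1 - ε) / s k := by
      rw [← sub_le_iff_le_add', le_div_iff₀ hsk]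
      nlinarith [sq_nonneg (s k - (1 - ε))]
    refine le_of_mul_le_mul_left ?_ hp
    have h3 := mul_le_mul_of_nonneg_left h2 hp.le
    have h4 : (1 - ε) * ((k : ℝ) + 1 + 2 * α) / s k =
      ((k : ℝ) + 1 + 2 * α) * ((1 - ε) / s k) := by ring
    have h5 : 1 - y = 3 * ε := by rw [hε]; ring
    rw [hrec]
    have hy' : y = 1 - 3 * ε := by linarith
    rw [h5]
    rw [hy'] at ha ⊢
    linarith
  obtain ⟨k₀, hk₀⟩ := eventually_atTop.1 hstep
  have hdec : ∀ j : ℕ, s (k₀ + j) ≤ s k₀ - j * (1 - y) := by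
    intro j
    induction j with
    | zero => simp
    | succ j ih =>
      have := hk₀ (k₀ + j) (by omega)
      push_cast
      rw [← add_assoc]
      linarith
  obtain ⟨j, hj⟩ := exists_nat_gt (s k₀ / (1 - y))
  rw [div_lt_iff₀ (by linarith)] at hj
  linarith [hdec j, hs0 (k₀ + j)]

lemma eventually_exists_root_gegenbauer {α : ℝ} (hα : -1 / 2 < α) {y : ℝ} (hy : y < 1) :
    ∀ᶠ n in atTop, ∃ z, y ≤ z ∧ (gegenbauer α (n + 1)).eval z = 0 := by
  choose z hz hpos hpos' using exists_largest_root_gegenbauer hα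
  have hmono : Monotone z := monotone_nat_of_le_succ fun k => by
    by_contra! h
    exact (hpos' (k + 1) (z k) h.le).ne' (hz k)
  -- The maximum with 0 covers negative `y`.
  obtain ⟨k, hk⟩ := exists_gegenbauer_eval_nonpos hα (le_max_right y 0) (max_lt hy zero_lt_one)
  have hyz : y ≤ z k := by
    by_contra! h
    exact absurd hk (not_le.2 (hpos' k _ (h.le.trans (le_max_left y 0))))
  filter_upwards [eventually_ge_atTop k] with n hn
  exact ⟨z n, hyz.trans (hmono hn), hz n⟩

/-- Chebyshev polynomials have modulus at least 1 outside `(-1, 1)`. For other `α` one large node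
suffices. -/
lemma sggNodes_zero_subset_Icc {L : ℝ} (hL : 0 < L) {n : ℕ} {x : ℝ} (hx : x ∈ sggNodes L 0 n) :
    x ∈ Icc 0 L := by
  have h := (Polynomial.mem_roots'.1 (Multiset.mem_toFinset.1 hx)).2
  rw [Polynomial.IsRoot, shiftedGegenbauer_eval, gegenbauer_zero_eq_T] at h
  have h1 : |2 / L * x - 1| ≤ 1 := by
    by_contra! h1
    have := Polynomial.Chebyshev.one_le_abs_eval_T_real ((n + 1 : ℕ) : ℤ) h1.le
    rw [h, abs_zero] at this
    linarith
  obtain ⟨h2, h3⟩ := abs_le.1 h1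
  have h4 : x = L / 2 * (2 / L * x) := by field_simp
  constructor
  · rw [h4]
    exact mul_nonneg (by positivity) (by linarith)
  · have := mul_le_mul_of_nonneg_left (show 2 / L * x ≤ 2 by linarith)
      (show 0 ≤ L / 2 by positivity)
    linarith

lemma eventually_exists_mem_sggNodes {α : ℝ} (hα : -1 / 2 < α) {c : ℝ} (hc : c < 1) :
    ∀ᶠ n in atTop, ∀ L : ℝ, 0 < L → ∃ x ∈ sggNodes L α n, c * L ≤ x := by
  filter_upwards [eventually_exists_root_gegenbauer hα (y := 2 * c - 1) (by linarith)]
    with n ⟨z, hz, hz0⟩ L hL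
  refine ⟨L * (z + 1) / 2, Multiset.mem_toFinset.2 (Polynomial.mem_roots'.2 ⟨fun h => ?_, ?_⟩), ?_⟩
  · have h1 := shiftedGegenbauer_eval L α (n + 1) L
    rw [h, Polynomial.eval_zero, div_mul_cancel₀ _ hL.ne', show (2 : ℝ) - 1 = 1 by norm_num,
      gegenbauer_eval_one hα] at h1
    exact zero_ne_one h1
  · rw [Polynomial.IsRoot, shiftedGegenbauer_eval,
      show 2 / L * (L * (z + 1) / 2) - 1 = z by field_simp; ring, hz0]
  · have := mul_le_mul_of_nonneg_left (show 2 * c ≤ z + 1 by linarith) hL.le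
    linarith

/-! ### Comparison of the truncation bounds -/

lemma rectMax_nonneg (l τ : ℝ) (v : ℝ → ℝ → ℝ) : 0 ≤ rectMax l τ v := by
  refine Real.sSup_nonneg ?_
  rintro _ ⟨p, _, rfl⟩
  exact abs_nonneg _

lemma truncBound_nonneg {l τ : ℝ} (hl : 0 < l) (hτ : 0 < τ) (β₁ β₂ : ℝ) (φ ψ f : ℝ → ℝ → ℝ)
    (α : ℝ) (Nx Nt Mt : ℕ) {x t : ℝ} (hx : 0 ≤ x) (ht : 0 ≤ t) :
    0 ≤ truncBound l τ β₁ β₂ φ ψ f α Nx Nt Mt x t := by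
  have hE := errFactor_nonneg
  have hM := rectMax_nonneg l τ
  simp only [truncBound]
  have h1 := hM (partialX l (Nx + 1) φ)
  have h2 := hM (partialT τ (Nt + 1) φ)
  have h3 := hM (partialX l (Nx + 1) (partialT τ (Nt + 1) φ))
  have h4 := hM (partialT τ (Mt + 1) ψ)
  have h5 := hM (partialT τ (Mt + 1) f)
  have e1 := hE l α Nx
  have e2 := hE τ α Nt
  have e3 := hE τ α Mt
  positivity

/-- The bound grows with the error factors, is monotone in `x` and `t`, and is a polynomial with
nonnegative coefficients of degree at most two in each of them. -/
lemma pow_mul_truncBound_le {l τ : ℝ} (hl : 0 < l) (hτ : 0 < τ) (β₁ β₂ : ℝ) (φ ψ f : ℝ → ℝ → ℝ)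
    {α ρ c : ℝ} (hρ : 1 ≤ ρ) (hc0 : 0 ≤ c) (hc1 : c ≤ 1) {Nx Nt Mt : ℕ}
    (hx : ρ * errFactor l 0 Nx ≤ errFactor l α Nx) (ht : ρ * errFactor τ 0 Nt ≤ errFactor τ α Nt)
    (hm : ρ * errFactor τ 0 Mt ≤ errFactor τ α Mt) {x t x' t' : ℝ} (hx0 : 0 ≤ x) (ht0 : 0 ≤ t)
    (hxx : c * x ≤ x') (htt : c * t ≤ t') :
    c ^ 4 * ρ * truncBound l τ β₁ β₂ φ ψ f 0 Nx Nt Mt x t ≤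
      truncBound l τ β₁ β₂ φ ψ f α Nx Nt Mt x' t' := by
  simp only [truncBound]
  have hM := rectMax_nonneg l τ
  have h1 := hM (partialX l (Nx + 1) φ)
  have h2 := hM (partialT τ (Nt + 1) φ)
  have h3 := hM (partialX l (Nx + 1) (partialT τ (Nt + 1) φ))
  have h4 := hM (partialT τ (Mt + 1) ψ)
  have h5 := hM (partialT τ (Mt + 1) f)
  have e1 := errFactor_nonneg l 0 Nx
  have e2 := errFactor_nonneg τ 0 Nt
  have e3 := errFactor_nonneg τ 0 Mt
  have hb1 := abs_nonneg β₁
  have hb2 := abs_nonneg β₂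
  set M1 := rectMax l τ (partialX l (Nx + 1) φ)
  set M2 := rectMax l τ (partialT τ (Nt + 1) φ)
  set M3 := rectMax l τ (partialX l (Nx + 1) (partialT τ (Nt + 1) φ))
  set M4 := rectMax l τ (partialT τ (Mt + 1) ψ)
  set M5 := rectMax l τ (partialT τ (Mt + 1) f)
  set E1 := errFactor l 0 Nx
  set E2 := errFactor τ 0 Nt
  set E3 := errFactor τ 0 Mt
  set F1 := errFactor l α Nx
  set F2 := errFactor τ α Nt
  set F3 := errFactor τ α Mt
  set b1 := |β₁|
  set b2 := |β₂|
  have hx0' : 0 ≤ x' := (mul_nonneg hc0 hx0).trans hxx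
  have ht0' : 0 ≤ t' := (mul_nonneg hc0 ht0).trans htt
  have hρ0 : 0 ≤ ρ := zero_le_one.trans hρ
  -- The mixed term contains `E1 * E2`: the factor `ρ` is spent on `E2`, so `E1 ≤ F1` is enough.
  have hEF1 : E1 ≤ F1 := (le_mul_of_one_le_left e1 hρ).trans hx
  have hX : c ^ 2 * (x * (l + x)) ≤ x' * (l + x') := by
    calc c ^ 2 * (x * (l + x)) = (c * x) * (c * l + c * x) := by ring
      _ ≤ x' * (l + x') := by
        gcongr
        exact mul_le_of_le_one_left hl.le hc1
  have hG : c * (2 * b1 + t * b2) ≤ 2 * b1 + t' * b2 := by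
    calc c * (2 * b1 + t * b2) = c * (2 * b1) + c * t * b2 := by ring
      _ ≤ 2 * b1 + t' * b2 :=
        add_le_add (mul_le_of_le_one_left (by positivity) hc1) (by gcongr)
  have hc4 : c ^ 4 ≤ c ^ 2 := pow_le_pow_of_le_one hc0 hc1 (by norm_num)
  have hc3 : c ^ 3 ≤ c := by simpa using pow_le_pow_of_le_one hc0 hc1 (show 1 ≤ 3 by norm_num)
  have hX0 : 0 ≤ x * (l + x) := by positivity
  have hX0' : 0 ≤ x' * (l + x') := by positivity
  set X := x * (l + x)
  set X' := x' * (l + x')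
  have hXG : c ^ 3 * (X * (2 * b1 + t * b2)) ≤ X' * (2 * b1 + t' * b2) := by
    calc c ^ 3 * (X * (2 * b1 + t * b2)) = (c ^ 2 * X) * (c * (2 * b1 + t * b2)) := by ring
      _ ≤ X' * (2 * b1 + t' * b2) := by gcongr
  have h2t : c ^ 3 * (2 * t) ≤ 2 * t' := by
    calc c ^ 3 * (2 * t) ≤ c * (2 * t) := by gcongr
      _ = 2 * (c * t) := by ring
      _ ≤ 2 * t' := by gcongr
  rw [mul_add, mul_add]
  refine add_le_add (add_le_add ?_ ?_) ?_
  · calc c ^ 4 * ρ * (l ^ (Nx + 1) / 2 ^ (Nx + 2) * X * M1 * E1)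
        = l ^ (Nx + 1) / 2 ^ (Nx + 2) * (c ^ 4 * X) * M1 * (ρ * E1) := by ring
      _ ≤ l ^ (Nx + 1) / 2 ^ (Nx + 2) * X' * M1 * F1 := by
        gcongr
        exact (mul_le_mul_of_nonneg_right hc4 hX0).trans hX
  · calc c ^ 4 * ρ * (τ ^ (Nt + 1) / 2 ^ (Nx + Nt + 4) * t * E2 *
          (2 ^ (Nx + 1) * M2 * (X * (2 * b1 + t * b2) + 2 * t)
            + l ^ (Nx + 1) * X * (2 * b1 + t * b2) * M3 * E1))
        = τ ^ (Nt + 1) / 2 ^ (Nx + Nt + 4) * (c * t) * (ρ * E2) *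
          (2 ^ (Nx + 1) * M2 * (c ^ 3 * (X * (2 * b1 + t * b2)) + c ^ 3 * (2 * t))
            + l ^ (Nx + 1) * (c ^ 3 * (X * (2 * b1 + t * b2))) * M3 * E1) := by ring
      _ ≤ τ ^ (Nt + 1) / 2 ^ (Nx + Nt + 4) * t' * F2 *
          (2 ^ (Nx + 1) * M2 * (X' * (2 * b1 + t' * b2) + 2 * t')
            + l ^ (Nx + 1) * (X' * (2 * b1 + t' * b2)) * M3 * F1) := by
        have : 0 ≤ F2 := (mul_nonneg hρ0 e2).trans ht
        gcongr
      _ = _ := by ring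
  · calc c ^ 4 * ρ * (τ ^ (Mt + 1) / 2 ^ (Mt + 2) * t * E3 *
          (t * (M4 * b2 + M5) + 2 * M4 * b1))
        = τ ^ (Mt + 1) / 2 ^ (Mt + 2) * (c * t) * (ρ * E3) *
          (c ^ 2 * (c * t) * (M4 * b2 + M5) + c ^ 3 * (2 * M4 * b1)) := by ring
      _ ≤ τ ^ (Mt + 1) / 2 ^ (Mt + 2) * t' * F3 * (1 * t' * (M4 * b2 + M5) + 1 * (2 * M4 * b1)) := by
        have : 0 ≤ F3 := (mul_nonneg hρ0 e3).trans hm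
        gcongr
        · exact pow_le_one₀ hc0 hc1
        · exact pow_le_one₀ hc0 hc1
      _ = _ := by ring

lemma le_chebTruncBound (l τ β₁ β₂ : ℝ) (f : ℝ → ℝ → ℝ) (h₁ h₂ : ℝ → ℝ) (u : ℝ → ℝ → ℝ) (α : ℝ)
    (N : ℕ × ℕ × ℕ) {x t : ℝ} (hx : x ∈ sggNodes l α N.1) (ht : t ∈ sggNodes τ α N.2.1) :
    solTruncBound l τ β₁ β₂ f h₁ h₂ u α N (x, t) ≤ chebTruncBound l τ β₁ β₂ f h₁ h₂ u α N := by
  refine le_csSup (Set.Finite.bddAbove (Set.Finite.image _ ?_)) ⟨(x, t), ⟨hx, ht⟩, rfl⟩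
  exact (sggNodes l α N.1 ×ˢ sggNodes τ α N.2.1).finite_toSet.subset
    fun p hp => Finset.mem_coe.2 (Finset.mem_product.2 hp)

lemma chebTruncBound_zero_nonneg {l τ : ℝ} (hl : 0 < l) (hτ : 0 < τ) (β₁ β₂ : ℝ)
    (f : ℝ → ℝ → ℝ) (h₁ h₂ : ℝ → ℝ) (u : ℝ → ℝ → ℝ) (N : ℕ × ℕ × ℕ) :
    0 ≤ chebTruncBound l τ β₁ β₂ f h₁ h₂ u 0 N := by
  refine Real.sSup_nonneg ?_
  rintro _ ⟨p, ⟨hx, ht⟩, rfl⟩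
  exact truncBound_nonneg hl hτ _ _ _ _ _ _ _ _ _ (sggNodes_zero_subset_Icc hl hx).1
    (sggNodes_zero_subset_Icc hτ ht).1

/-- A uniform lower bound on the ratio of the error factors gives every smaller lower bound on the
ratio of the truncation error bounds. -/
lemma eventually_mul_bounds_le {l τ : ℝ} (hl : 0 < l) (hτ : 0 < τ) (β₁ β₂ : ℝ)
    (f : ℝ → ℝ → ℝ) (h₁ h₂ : ℝ → ℝ) (u : ℝ → ℝ → ℝ) {α ρ ρ' : ℝ} (hα : -1 / 2 < α) (hρ : 1 ≤ ρ)
    (hρρ' : ρ < ρ')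
    (hE : ∀ᶠ n in atTop, ∀ L : ℝ, 0 < L → ρ' * errFactor L 0 n ≤ errFactor L α n) :
    ∀ᶠ N : ℕ × ℕ × ℕ in atTop,
      ρ * chebTruncBound l τ β₁ β₂ f h₁ h₂ u 0 N ≤ chebTruncBound l τ β₁ β₂ f h₁ h₂ u α N ∧
      ∀ p ∈ rect l τ,
        ρ * solTruncBound l τ β₁ β₂ f h₁ h₂ u 0 N p ≤
          solTruncBound l τ β₁ β₂ f h₁ h₂ u α N p := by
  have hρ' : 1 ≤ ρ' := hρ.trans hρρ'.le
  have hρ0 : 0 < ρ := zero_lt_one.trans_le hρ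
  have hρ0' : 0 < ρ' := hρ0.trans hρρ'
  obtain ⟨c, hc0, hc1, hc⟩ : ∃ c : ℝ, 0 ≤ c ∧ c < 1 ∧ ρ ≤ c ^ 4 * ρ' := by
    have hq : ρ / ρ' < 1 := (div_lt_one hρ0').2 hρρ'
    have hq0 : 0 < ρ / ρ' := div_pos hρ0 hρ0'
    -- Bernoulli's inequality turns this choice into `c ^ 4 ≥ ρ / ρ'`.
    refine ⟨1 + -((1 - ρ / ρ') / 4), by linarith, by linarith, ?_⟩
    have := one_add_mul_le_pow (a := -((1 - ρ / ρ') / 4)) (by linarith) 4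
    rw [← div_le_iff₀ hρ0']
    refine le_trans ?_ this
    push_cast
    linarith
  obtain ⟨n₁, hn₁⟩ := eventually_atTop.1 hE
  obtain ⟨n₂, hn₂⟩ := eventually_atTop.1 (eventually_exists_mem_sggNodes hα hc1)
  filter_upwards [eventually_ge_atTop ((max n₁ n₂, max n₁ n₂, max n₁ n₂) : ℕ × ℕ × ℕ)]
    with N ⟨hNx, hNt, hMt⟩
  replace hNx : max n₁ n₂ ≤ N.1 := hNx
  replace hNt : max n₁ n₂ ≤ N.2.1 := hNt
  replace hMt : max n₁ n₂ ≤ N.2.2 := hMt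
  have E1 := hn₁ N.1 ((le_max_left _ _).trans hNx) l hl
  have E2 := hn₁ N.2.1 ((le_max_left _ _).trans hNt) τ hτ
  have E3 := hn₁ N.2.2 ((le_max_left _ _).trans hMt) τ hτ
  constructor
  · obtain ⟨x', hx', hxl⟩ := hn₂ N.1 ((le_max_right _ _).trans hNx) l hl
    obtain ⟨t', ht', htτ⟩ := hn₂ N.2.1 ((le_max_right _ _).trans hNt) τ hτ
    have hle := le_chebTruncBound l τ β₁ β₂ f h₁ h₂ u α N hx' ht'
    -- `Real.sSup_le` needs a nonnegative bound, because the supremum of the empty set is 0.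
    have hnn : 0 ≤ chebTruncBound l τ β₁ β₂ f h₁ h₂ u α N :=
      (truncBound_nonneg hl hτ β₁ β₂ _ _ f α N.1 N.2.1 N.2.2 ((mul_nonneg hc0 hl.le).trans hxl)
        ((mul_nonneg hc0 hτ.le).trans htτ)).trans hle
    rw [mul_comm, ← le_div_iff₀ hρ0]
    refine Real.sSup_le ?_ (div_nonneg hnn hρ0.le)
    rintro _ ⟨⟨x, t⟩, ⟨hx, ht⟩, rfl⟩
    replace hx := sggNodes_zero_subset_Icc hl hx
    replace ht := sggNodes_zero_subset_Icc hτ ht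
    rw [le_div_iff₀ hρ0, mul_comm]
    refine le_trans ?_ hle
    refine (mul_le_mul_of_nonneg_right hc
      (truncBound_nonneg hl hτ β₁ β₂ _ _ f 0 N.1 N.2.1 N.2.2 hx.1 ht.1)).trans ?_
    exact pow_mul_truncBound_le hl hτ β₁ β₂ _ _ f hρ' hc0 hc1.le E1 E2 E3 hx.1 ht.1
      ((mul_le_mul_of_nonneg_left hx.2 hc0).trans hxl)
      ((mul_le_mul_of_nonneg_left ht.2 hc0).trans htτ)
  · rintro ⟨x, t⟩ ⟨hx, ht⟩
    -- At a common point nothing is lost to the grids, so `c = 1`.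
    have h := pow_mul_truncBound_le hl hτ β₁ β₂ (partialX l 2 u) (boundaryLift l h₁ h₂) f hρ'
      zero_le_one le_rfl E1 E2 E3 hx.1 ht.1 (one_mul x).le (one_mul t).le
    rw [one_pow, one_mul] at h
    exact (mul_le_mul_of_nonneg_right hρρ'.le
      (truncBound_nonneg hl hτ β₁ β₂ _ _ f 0 N.1 N.2.1 N.2.2 hx.1 ht.1)).trans h

theorem mainTheorem7 (l τ β₁ β₂ : ℝ) (hl : 0 < l) (hτ : 0 < τ)
    (f : ℝ → ℝ → ℝ) (g₁ g₂ h₁ h₂ : ℝ → ℝ) (u : ℝ → ℝ → ℝ)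
    (hu : ContDiffOn ℝ ∞ (fun p : ℝ × ℝ => u p.1 p.2) (rect l τ))
    (hf : ContDiffOn ℝ ∞ (fun p : ℝ × ℝ => f p.1 p.2) (rect l τ))
    (hh₁ : ContDiffOn ℝ ∞ h₁ (Icc 0 τ)) (hh₂ : ContDiffOn ℝ ∞ h₂ (Icc 0 τ))
    (hsol : IsTelegraphSolution l τ β₁ β₂ f g₁ g₂ h₁ h₂ u)
    (α : ℝ) (hα : -1 / 2 < α) (hα0 : α ≠ 0) :
    -- in the maximum norm over the grid, the bound at `0` is smaller (unless both vanish)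
    (∀ᶠ N : ℕ × ℕ × ℕ in atTop,
      chebTruncBound l τ β₁ β₂ f h₁ h₂ u 0 N < chebTruncBound l τ β₁ β₂ f h₁ h₂ u α N ∨
        (chebTruncBound l τ β₁ β₂ f h₁ h₂ u 0 N = 0 ∧
          chebTruncBound l τ β₁ β₂ f h₁ h₂ u α N = 0)) ∧
    -- it is so by a factor above `1`, on the grids and at every fixed point of the rectangle
    (∃ ρ : ℝ, 1 < ρ ∧ ∀ᶠ N : ℕ × ℕ × ℕ in atTop,
      ρ * chebTruncBound l τ β₁ β₂ f h₁ h₂ u 0 N ≤ chebTruncBound l τ β₁ β₂ f h₁ h₂ u α N ∧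
      ∀ p ∈ rect l τ,
        ρ * solTruncBound l τ β₁ β₂ f h₁ h₂ u 0 N p ≤ solTruncBound l τ β₁ β₂ f h₁ h₂ u α N p) ∧
    -- for positive `α` the factor is arbitrarily large
    (0 < α → ∀ R : ℝ, ∀ᶠ N : ℕ × ℕ × ℕ in atTop,
      R * chebTruncBound l τ β₁ β₂ f h₁ h₂ u 0 N ≤ chebTruncBound l τ β₁ β₂ f h₁ h₂ u α N ∧
      ∀ p ∈ rect l τ,
        R * solTruncBound l τ β₁ β₂ f h₁ h₂ u 0 N p ≤ solTruncBound l τ β₁ β₂ f h₁ h₂ u α N p) := by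
  have key : ∃ ρ : ℝ, 1 < ρ ∧ ∀ᶠ N : ℕ × ℕ × ℕ in atTop,
      ρ * chebTruncBound l τ β₁ β₂ f h₁ h₂ u 0 N ≤ chebTruncBound l τ β₁ β₂ f h₁ h₂ u α N ∧
      ∀ p ∈ rect l τ,
        ρ * solTruncBound l τ β₁ β₂ f h₁ h₂ u 0 N p ≤
          solTruncBound l τ β₁ β₂ f h₁ h₂ u α N p := by
    rcases hα0.lt_or_gt with h | h
    -- Any number strictly between 1 and the ratio `1 - α / 2` would do.
    · refine ⟨1 - α / 4, by linarith, eventually_mul_bounds_le hl hτ β₁ β₂ f h₁ h₂ u hα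
        (ρ' := 1 - α / 2) (by linarith) (by linarith) ?_⟩
      filter_upwards [eventually_ge_atTop 2] with n hn L hL
      exact one_sub_half_mul_errFactor_le hα h hL hn
    · exact ⟨2, one_lt_two, eventually_mul_bounds_le hl hτ β₁ β₂ f h₁ h₂ u hα (ρ' := 3)
        one_le_two (by norm_num) (eventually_mul_errFactor_le h (by norm_num))⟩
  refine ⟨?_, key, fun h R => ?_⟩
  · obtain ⟨ρ, hρ, hev⟩ := key
    filter_upwards [hev] with N hN
    have h0 := chebTruncBound_zero_nonneg hl hτ β₁ β₂ f h₁ h₂ u N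
    rcases h0.eq_or_lt with h1 | h1
    · have h2 := hN.1
      rw [← h1, mul_zero] at h2
      rcases h2.eq_or_lt with h3 | h3
      · exact Or.inr ⟨h1.symm, h3.symm⟩
      · exact Or.inl (h1 ▸ h3)
    · exact Or.inl ((lt_mul_of_one_lt_left h1 hρ).trans_le hN.1)
  -- The comparison needs a factor at least 1, whereas `R` is arbitrary; nonnegativity of the bounds
  -- at `0` lets `max R 1` replace `R`.
  · filter_upwards [eventually_mul_bounds_le hl hτ β₁ β₂ f h₁ h₂ u hα (ρ := max R 1)
      (ρ' := max R 1 + 1) (le_max_right _ _) (lt_add_one _)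
      (eventually_mul_errFactor_le h (by positivity))] with N hN
    refine ⟨(mul_le_mul_of_nonneg_right (le_max_left R 1)
      (chebTruncBound_zero_nonneg hl hτ β₁ β₂ f h₁ h₂ u N)).trans hN.1, fun p hp => ?_⟩
    exact (mul_le_mul_of_nonneg_right (le_max_left R 1)
      (truncBound_nonneg hl hτ β₁ β₂ _ _ f 0 N.1 N.2.1 N.2.2 hp.1.1 hp.2.1)).trans (hN.2 p hp)
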